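/- Let $B=(B_t)_{t\ge 0}$ be a one-dimensional Brownian motion on a complete probability space $(\Omega,\mathcal F,\mathbb P)$ and let $\mathcal F_t$ be the $\sigma$-algebra generated by $(B_s)_{s\le t}$ and the $\mathbb P$-null sets. Let $\mu,r\in\mathbb R$, $\sigma>0$, $\tau>0$, $\gamma>0$, $\alpha\in(0,1)$, $k\ge 0$, $\delta>0$ be constants such that $$\phi:=\frac{\mu-r}{\sigma}\neq 0,\qquad \delta>h:=r\alpha+\frac{\alpha\phi^2}{2(1-\alpha)}.$$ Put $Z_\tau:=\exp\left(-\phi B_\tau-(r+\phi^2/2)\tau\right)$, let $\mathcal Y$ be the set of $\mathcal F_\tau$-measurable random variables $Y\ge 0$ with $\mathbb E[Z_\tau Y]\le 1$, and define $U(x):=x^\alpha$ for $x\ge 0$, $U(x):=-k|x|^\alpha$ for $x<0$, and $$F(y;\theta):=U(y-\gamma)+\theta y^\alpha,\qquad \Phi(\theta):=\sup_{Y\in\mathcal Y}\mathbb E[F(Y;\theta)],\qquad \underline\theta:=-\left(1+k^{\frac1{1-\alpha}}\right)^{1-\alpha}.$$ For $\kappa\in[0,1]$ let $\theta^*(\kappa)$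 be the unique real number with $\theta^*(\kappa)=e^{-\delta\tau}\Phi(\kappa\theta^*(\kappa))$. Fix $\beta\in(0,1)$; for $\xi\in[0,e^{h\tau}]$ put $\kappa(\xi):=\dfrac{\beta}{1-(1-\beta)e^{-\delta\tau}\xi}$ and $$G(\xi):=\left\{\mathbb E[Y^\alpha]\;:\;Y\in\operatorname*{arg\,max}_{Y\in\mathcal Y}\mathbb E\left[F\left(Y;\kappa(\xi)\theta^*(\kappa(\xi))\right)\right]\right\}.$$ Let $\hat\xi\in[0,e^{h\tau}]$ be any fixed point of $G$, i.e. $\hat\xi\in G(\hat\xi)$, and set $$A_{\mathrm{my}}:=\theta^*(0),\qquad A_{\mathrm{expo}}:=\theta^*(1),\qquad A_{\mathrm{so}}:=\kappa(\hat\xi)\,\theta^*(\kappa(\hat\xi)),$$ and, when $A_{\mathrm{my}}\ne 0$, $\hat\beta:=A_{\mathrm{so}}/A_{\mathrm{expo}}$. Then: 1. If $A_{\mathrm{my}}=0$, then $\beta A_{\mathrm{expo}}=A_{\mathrm{expo}}=A_{\mathrm{so}}=0$. 2. If $A_{\mathrm{my}}>0$, then $0<A_{\mathrm{so}}<\beta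 A_{\mathrm{expo}}<A_{\mathrm{expo}}$; in particular $\hat\beta\in(0,\beta)$. 3. If $A_{\mathrm{my}}<0$, then $A_{\mathrm{expo}}<A_{\mathrm{so}}\le\beta A_{\mathrm{expo}}<0$; in particular $\hat\beta\in[\beta,1)$. If moreover $A_{\mathrm{expo}}\ge\underline\theta$, then $A_{\mathrm{so}}<\beta A_{\mathrm{expo}}$ and $\hat\beta>\beta$. -/

import Mathlib

open MeasureTheory ProbabilityTheory
open scoped NNReal ENNReal

namespace PeriodicPortfolio

/-- The numerical parameters of the model: drift `μ` and volatility `σ` of the risky asset, the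
risk-free rate `r`, the length `τ` of an evaluation period, the benchmark `γ`, the utility
parameters `α` and `k`, and the discount rate `δ`. -/
structure Params where
  μ : ℝ
  r : ℝ
  σ : ℝ
  τ : ℝ≥0
  γ : ℝ
  α : ℝ
  k : ℝ
  δ : ℝ

namespace Params

noncomputable section

/-- The market price of risk. -/
def φ (p : Params) : ℝ := (p.μ - p.r) / p.σ

/-- The growth constant of the one-period Merton problem. -/
def h (p : Params) : ℝ := p.r * p.α + p.α * p.φ ^ 2 / (2 * (1 - p.α))

/-- The standing assumptions on the parameters. -/
structure Standing (p : Params) : Prop where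
  σ_pos : 0 < p.σ
  φ_ne_zero : p.φ ≠ 0
  τ_pos : 0 < p.τ
  γ_pos : 0 < p.γ
  α_pos : 0 < p.α
  α_lt_one : p.α < 1
  k_nonneg : 0 ≤ p.k
  δ_pos : 0 < p.δ
  h_lt_δ : p.h < p.δ

/-- The piecewise power utility function. -/
def U (p : Params) (x : ℝ) : ℝ := if 0 ≤ x then x ^ p.α else -p.k * |x| ^ p.α

/-- The effective utility `F(y; θ) = U(y - γ) + θ y ^ α`. -/
def F (p : Params) (y θ : ℝ) : ℝ := p.U (y - p.γ) + θ * y ^ p.α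

/-- The threshold `-(1 + k ^ (1 / (1 - α))) ^ (1 - α)`. -/
def thetaLow (p : Params) : ℝ := -(1 + p.k ^ (1 / (1 - p.α))) ^ (1 - p.α)

end

end Params

noncomputable section

variable {Ω : Type*} [MeasurableSpace Ω]

/-- The σ-algebra at time `t` of the augmented filtration of `B`: it is generated by the `B s`
with `s ≤ t` and the `P`-null sets. -/
abbrev augmentedSigma (P : Measure Ω) (B : ℝ≥0 → Ω → ℝ) (t : ℝ≥0) : MeasurableSpace Ω :=
  (⨆ s : Set.Iic t, MeasurableSpace.comap (B s) inferInstance) ⊔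
    MeasurableSpace.generateFrom {N : Set Ω | P N = 0}

/-- The pricing kernel of the Black-Scholes market driven by `B`. -/
def kernelZ (p : Params) (B : ℝ≥0 → Ω → ℝ) (t : ℝ≥0) (ω : Ω) : ℝ :=
  Real.exp (-p.φ * B t ω - (p.r + p.φ ^ 2 / 2) * t)

/-- The admissible one-period gross returns: the nonnegative random variables `Y`, measurable with
respect to the information at time `τ`, with `E[Z_τ Y] ≤ 1` (an expectation in `[0, ∞]`). -/
def returns (p : Params) (P : Measure Ω) (B : ℝ≥0 → Ω → ℝ) : Set (Ω → ℝ) :=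
  {Y | Measurable[augmentedSigma P B p.τ] Y ∧ (∀ ω, 0 ≤ Y ω) ∧
    ∫⁻ ω, ENNReal.ofReal (kernelZ p B p.τ ω * Y ω) ∂P ≤ 1}

/-- The objective `E[F(Y; θ)]`. -/
def objective (p : Params) (P : Measure Ω) (θ : ℝ) (Y : Ω → ℝ) : ℝ :=
  ∫ ω, p.F (Y ω) θ ∂P

/-- The value `Φ(θ) = sup_Y E[F(Y; θ)]` over the admissible gross returns. -/
def Phi (p : Params) (P : Measure Ω) (B : ℝ≥0 → Ω → ℝ) (θ : ℝ) : ℝ :=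
  sSup (objective p P θ '' returns p P B)

/-- The maximizers of `E[F(Y; θ)]` over the admissible gross returns. -/
def argmaxSet (p : Params) (P : Measure Ω) (B : ℝ≥0 → Ω → ℝ) (θ : ℝ) : Set (Ω → ℝ) :=
  {Y ∈ returns p P B | IsMaxOn (objective p P θ) (returns p P B) Y}

/-- The number `θ*(κ)`, for `κ ∈ [0, 1]`: the (unique) fixed point of `θ ↦ e ^ (-δτ) Φ(κ θ)`. -/
def thetaStar (p : Params) (P : Measure Ω) (B : ℝ≥0 → Ω → ℝ) (κ : ℝ) : ℝ :=
  Classical.epsilon fun θ : ℝ =>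
    Function.IsFixedPt (fun x : ℝ => Real.exp (-p.δ * p.τ) * Phi p P B (κ * x)) θ

/-- The factor `β / (1 - (1 - β) e ^ (-δτ) ξ)`. -/
def kappa (p : Params) (β ξ : ℝ) : ℝ := β / (1 - (1 - β) * Real.exp (-p.δ * p.τ) * ξ)

/-- The set-valued map `G`: the values `E[Y ^ α]` of the maximizers `Y` of
`E[F(Y; κ θ*(κ))]`, where `κ = β / (1 - (1 - β) e ^ (-δτ) ξ)`. -/
def mapG (p : Params) (P : Measure Ω) (B : ℝ≥0 → Ω → ℝ) (β ξ : ℝ) : Set ℝ :=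
  (fun Y : Ω → ℝ => ∫ ω, Y ω ^ p.α ∂P) ''
    argmaxSet p P B (kappa p β ξ * thetaStar p P B (kappa p β ξ))

/-- The constant of the completely myopic agent. -/
def Amy (p : Params) (P : Measure Ω) (B : ℝ≥0 → Ω → ℝ) : ℝ := thetaStar p P B 0

/-- The constant of the exponential discounter. -/
def Aexpo (p : Params) (P : Measure Ω) (B : ℝ≥0 → Ω → ℝ) : ℝ := thetaStar p P B 1

/-- The constant of the sophisticated agent with present bias `β`, for a given fixed point `ξ`
of `mapG`. -/
def Aso (p : Params) (P : Measure Ω) (B : ℝ≥0 → Ω → ℝ) (β ξ : ℝ) : ℝ :=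
  kappa p β ξ * thetaStar p P B (kappa p β ξ)

/-- The adjusted present bias `A_so / A_expo`. -/
def betaHat (p : Params) (P : Measure Ω) (B : ℝ≥0 → Ω → ℝ) (β ξ : ℝ) : ℝ :=
  Aso p P B β ξ / Aexpo p P B

end

end PeriodicPortfolio

/-!
The value function `Φ` is a supremum of functions affine in `θ` whose slopes `E[Y ^ α]` lie in
`[0, e ^ (hτ)]`, so `e ^ (-δτ) Φ` is a convex contraction, and the sign of each fixed point
`θ*(κ)` is the sign of `Φ 0`. At a fixed point `ξ` of `G`, the number `s = e ^ (-δτ) ξ < 1` is the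
slope of a tangent line to `e ^ (-δτ) Φ` at `A_so`, and the definition of `κ(ξ)` says precisely that
this line meets the diagonal at `A_so / β`. Since the graph lies above its tangent,
`A_so / β ≤ A_expo`.

Strictness: if equality held, one payoff `Y` would be optimal for two distinct weights `θ`. Where
`Y > γ`, the first-order condition makes the derivative of `F(·; θ)` at `Y` proportional to `Z_τ`
for both weights, which forces `Z_τ` to be constant there, while `Z_τ` has no atoms. Hence `Y ≤ γ`
almost surely; this is impossible when `θ > θ_low`, because moving a little budget into the states
where `Z_τ` is small would raise the expected utility.
-/

namespace PeriodicPortfolio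

section FixedPoint

variable {f : ℝ → ℝ} {K : ℝ≥0} {x E : ℝ}

lemma strictAnti_sub_id_of_contractingWith (hf : ContractingWith K f) :
    StrictAnti fun x => f x - x := by
  intro x y hxy
  have hdist : f y - f x ≤ K * (y - x) := by
    have := hf.toLipschitzWith.dist_le_mul y x
    rw [Real.dist_eq, Real.dist_eq, abs_of_pos (sub_pos.2 hxy)] at this
    exact (le_abs_self _).trans this
  have hlt : (K : ℝ) * (y - x) < y - x :=
    mul_lt_of_lt_one_left (sub_pos.2 hxy) (NNReal.coe_lt_one.2 hf.1)
  dsimp only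
  linarith

lemma lt_fixedPt_iff (hf : StrictAnti fun x => f x - x) (hE : f E = E) : x < E ↔ x < f x := by
  have := hf.lt_iff_gt (a := E) (b := x)
  simpa only [hE, sub_self, sub_pos] using this.symm

lemma fixedPt_lt_iff (hf : StrictAnti fun x => f x - x) (hE : f E = E) : E < x ↔ f x < x := by
  have := hf.lt_iff_gt (a := x) (b := E)
  simpa only [hE, sub_self, sub_neg] using this.symm

lemma le_fixedPt_iff (hf : StrictAnti fun x => f x - x) (hE : f E = E) : x ≤ E ↔ x ≤ f x := by
  rw [← not_lt, fixedPt_lt_iff hf hE, not_lt]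

lemma contractingWith_comp_const_mul (hf : ContractingWith K f) {κ : ℝ} (hκ : κ ∈ Set.Icc 0 1) :
    ContractingWith K fun x => f (κ * x) := by
  refine ⟨hf.1, LipschitzWith.of_dist_le_mul fun x y => ?_⟩
  refine (hf.toLipschitzWith.dist_le_mul _ _).trans (mul_le_mul_of_nonneg_left ?_ K.2)
  rw [Real.dist_eq, Real.dist_eq, ← mul_sub, abs_mul, abs_of_nonneg hκ.1]
  exact mul_le_of_le_one_left (abs_nonneg _) hκ.2

end FixedPoint

section Budget

/-- The nonnegative claims measurable with respect to the information `m` whose price under the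
pricing kernel `Z` is at most `1`. The price is an integral in `[0, ∞]`. -/
def budgetSet {Ω : Type*} (m : MeasurableSpace Ω) [MeasurableSpace Ω] (P : Measure Ω)
    (Z : Ω → ℝ) : Set (Ω → ℝ) :=
  {Y | Measurable[m] Y ∧ (∀ ω, 0 ≤ Y ω) ∧ ∫⁻ ω, ENNReal.ofReal (Z ω * Y ω) ∂P ≤ 1}

/-- A positive pricing kernel `Z` known from the information `m`. The `σ`-algebra `m` need not be
contained in the one carrying `P`: it may contain null sets that are not measurable. -/
structure IsPricingKernel {Ω : Type*} (m : MeasurableSpace Ω) [MeasurableSpace Ω]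
    (P : Measure Ω) (Z : Ω → ℝ) : Prop where
  nullMeasurableSet : ∀ s, MeasurableSet[m] s → NullMeasurableSet s P
  measurable : Measurable[m] Z
  pos : ∀ ω, 0 < Z ω

variable {Ω : Type*} {m : MeasurableSpace Ω} [mΩ : MeasurableSpace Ω] {P : Measure Ω}
  {X Y Z : Ω → ℝ}

namespace IsPricingKernel

variable (hZ : IsPricingKernel m P Z)
include hZ

lemma aemeasurable_of_measurable (hX : Measurable[m] X) : AEMeasurable X P :=
  NullMeasurable.aemeasurable fun _ hs => hZ.nullMeasurableSet _ (hX hs)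

lemma mem_budgetSet_iff : Y ∈ budgetSet m P Z ↔ Measurable[m] Y ∧ (∀ ω, 0 ≤ Y ω) ∧
    Integrable (fun ω => Z ω * Y ω) P ∧ ∫ ω, Z ω * Y ω ∂P ≤ 1 := by
  refine and_congr_right fun hY => and_congr_right fun hY0 => ?_
  have hZY : 0 ≤ᵐ[P] fun ω => Z ω * Y ω := ae_of_all _ fun ω => mul_nonneg (hZ.pos ω).le (hY0 ω)
  have hmeas : AEStronglyMeasurable (fun ω => Z ω * Y ω) P :=
    (hZ.aemeasurable_of_measurable (hZ.measurable.mul hY)).aestronglyMeasurable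
  have hprice (hi : Integrable (fun ω => Z ω * Y ω) P) :
      ∫⁻ ω, ENNReal.ofReal (Z ω * Y ω) ∂P ≤ 1 ↔ ∫ ω, Z ω * Y ω ∂P ≤ 1 := by
    rw [← ofReal_integral_eq_lintegral_ofReal hi hZY, ENNReal.ofReal_le_one]
  refine ⟨fun h => ?_, fun ⟨hi, h⟩ => (hprice hi).2 h⟩
  have hi : Integrable (fun ω => Z ω * Y ω) P :=
    ⟨hmeas, (hasFiniteIntegral_iff_ofReal hZY).2 (h.trans_lt ENNReal.one_lt_top)⟩
  exact ⟨hi, (hprice hi).1 h⟩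

end IsPricingKernel

lemma zero_mem_budgetSet : 0 ∈ budgetSet m P Z :=
  ⟨measurable_const, fun _ => le_rfl, by simp⟩

variable {α : ℝ}

lemma IsPricingKernel.lintegral_rpow_le (hZ : IsPricingKernel m P Z) (hα : α ∈ Set.Ioo 0 1)
    (hY : Y ∈ budgetSet m P Z) :
    ∫⁻ ω, ENNReal.ofReal (Y ω ^ α) ∂P
      ≤ (∫⁻ ω, ENNReal.ofReal (Z ω ^ (-(α / (1 - α)))) ∂P) ^ (1 - α) := by
  have hα' : 0 < 1 - α := sub_pos.2 hα.2
  have hpoint (ω : Ω) : ENNReal.ofReal (Y ω ^ α)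
      = ENNReal.ofReal (Z ω * Y ω) ^ α
        * ENNReal.ofReal (Z ω ^ (-(α / (1 - α)))) ^ (1 - α) := by
    have hz := hZ.pos ω
    have hy := hY.2.1 ω
    rw [ENNReal.ofReal_rpow_of_nonneg (by positivity) hα.1.le,
      ENNReal.ofReal_rpow_of_nonneg (by positivity) hα'.le, ← ENNReal.ofReal_mul (by positivity),
      ← Real.rpow_mul hz.le, neg_mul, div_mul_cancel₀ _ hα'.ne', Real.mul_rpow hz.le hy,
      mul_right_comm, ← Real.rpow_add hz, add_neg_cancel, Real.rpow_zero, one_mul]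
  calc ∫⁻ ω, ENNReal.ofReal (Y ω ^ α) ∂P
      = ∫⁻ ω, ENNReal.ofReal (Z ω * Y ω) ^ α
          * ENNReal.ofReal (Z ω ^ (-(α / (1 - α)))) ^ (1 - α) ∂P := lintegral_congr hpoint
    _ ≤ (∫⁻ ω, ENNReal.ofReal (Z ω * Y ω) ∂P) ^ α
          * (∫⁻ ω, ENNReal.ofReal (Z ω ^ (-(α / (1 - α)))) ∂P) ^ (1 - α) :=
        ENNReal.lintegral_mul_norm_pow_le
          (hZ.aemeasurable_of_measurable (hZ.measurable.mul hY.1)).ennreal_ofReal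
          (hZ.aemeasurable_of_measurable (hZ.measurable.pow_const _)).ennreal_ofReal
          hα.1.le hα'.le (add_sub_cancel _ _)
    _ ≤ (∫⁻ ω, ENNReal.ofReal (Z ω ^ (-(α / (1 - α)))) ∂P) ^ (1 - α) :=
        mul_le_of_le_one_left' (ENNReal.rpow_le_one hY.2.2 hα.1.le)

end Budget

lemma exists_ae_eq_const_mul_of_orthogonal {Ω : Type*} [MeasurableSpace Ω] {μ : Measure Ω}
    {W Z : Ω → ℝ} (hW : MemLp W 2 μ) (hZ : MemLp Z 2 μ) (hZ0 : ∫ ω, Z ω * Z ω ∂μ ≠ 0)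
    (h : ∀ c : ℝ, ∫ ω, Z ω * (W ω - c * Z ω) ∂μ = 0 → ∫ ω, W ω * (W ω - c * Z ω) ∂μ = 0) :
    ∃ c : ℝ, ∀ᵐ ω ∂μ, W ω = c * Z ω := by
  have integrable_mul {X X' : Ω → ℝ} (hX : MemLp X 2 μ) (hX' : MemLp X' 2 μ) :
      Integrable (fun ω => X ω * X' ω) μ := hX.integrable_mul hX'
  set c := (∫ ω, Z ω * W ω ∂μ) / ∫ ω, Z ω * Z ω ∂μ with hc
  have hη : MemLp (fun ω => W ω - c * Z ω) 2 μ := hW.sub (hZ.const_mul c)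
  have hZη : ∫ ω, Z ω * (W ω - c * Z ω) ∂μ = 0 := by
    simp only [mul_sub, mul_left_comm _ c]
    rw [integral_sub (integrable_mul hZ hW) ((integrable_mul hZ hZ).const_mul c),
      integral_const_mul, hc, div_mul_cancel₀ _ hZ0, sub_self]
  have hηη : ∫ ω, (W ω - c * Z ω) * (W ω - c * Z ω) ∂μ = 0 := by
    simp only [sub_mul (W _), mul_assoc c]
    rw [integral_sub (integrable_mul hW hη) ((integrable_mul hZ hη).const_mul c),
      integral_const_mul, h c hZη, hZη, mul_zero, sub_self]
  rw [integral_eq_zero_iff_of_nonneg (fun _ => mul_self_nonneg _) (integrable_mul hη hη)] at hηη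
  exact ⟨c, hηη.mono fun ω hω => sub_eq_zero.1 (mul_self_eq_zero.1 hω)⟩

lemma lt_add_mul_of_abs_lt_div {a c C x y z : ℝ} (hC : 0 < C) (hx : |x| < c / C) (hz : |z| ≤ C)
    (hy : a + c ≤ y) : a < y + x * z := by
  have hxz : |x * z| < c := calc
    |x * z| = |x| * |z| := abs_mul x z
    _ ≤ |x| * C := mul_le_mul_of_nonneg_left hz (abs_nonneg x)
    _ < c := (lt_div_iff₀ hC).1 hx
  linarith [neg_lt_of_abs_lt hxz]

section FirstOrder

variable {Ω : Type*} {m : MeasurableSpace Ω} [mΩ : MeasurableSpace Ω] {P : Measure Ω}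
  {Y Z η : Ω → ℝ} {D : Set Ω} {f : ℝ → ℝ} {a c C K : ℝ}

lemma hasDerivAt_integral_comp_add_mul [IsFiniteMeasure P] (hfm : Measurable f)
    (hf : ∀ y, a < y → DifferentiableAt ℝ f y) (hf' : ∀ y, a < y → |deriv f y| ≤ K)
    (hYm : AEMeasurable Y P) (hfY : Integrable (fun ω => f (Y ω)) P) (hηm : AEMeasurable η P)
    (hC : 0 < C) (hηC : ∀ ω, |η ω| ≤ C) (hc : 0 < c) (hηY : ∀ ω, η ω ≠ 0 → a + c ≤ Y ω) :
    HasDerivAt (fun x => ∫ ω, f (Y ω + x * η ω) ∂P) (∫ ω, deriv f (Y ω) * η ω ∂P) 0 := by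
  have hK : 0 ≤ K := (abs_nonneg _).trans (hf' (a + 1) (lt_add_one a))
  have habove : ∀ x ∈ Metric.ball (0 : ℝ) (c / C), ∀ ω, η ω ≠ 0 → a < Y ω + x * η ω :=
    fun x hx ω hω =>
      lt_add_mul_of_abs_lt_div hC (mem_ball_zero_iff.1 hx) (hηC ω) (hηY ω hω)
  have hbound : ∀ x ∈ Metric.ball (0 : ℝ) (c / C), ∀ ω,
      ‖deriv f (Y ω + x * η ω) * η ω‖ ≤ K * C := by
    intro x hx ω
    by_cases hω : η ω = 0
    · simpa only [hω, mul_zero, norm_zero] using mul_nonneg hK hC.le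
    · rw [norm_mul]
      exact mul_le_mul (hf' _ (habove x hx ω hω)) (hηC ω) (abs_nonneg _) hK
  have hderiv : ∀ x ∈ Metric.ball (0 : ℝ) (c / C), ∀ ω,
      HasDerivAt (fun x => f (Y ω + x * η ω)) (deriv f (Y ω + x * η ω) * η ω) x := by
    intro x hx ω
    by_cases hω : η ω = 0
    · simpa only [hω, mul_zero] using hasDerivAt_const x (f (Y ω + 0))
    · exact (hf _ (habove x hx ω hω)).hasDerivAt.comp x
        ((((hasDerivAt_id x).mul_const (η ω)).const_add (Y ω)).congr_deriv (one_mul _))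
  simpa only [zero_mul, add_zero] using (hasDerivAt_integral_of_dominated_loc_of_deriv_le
    (μ := P) (F := fun x ω => f (Y ω + x * η ω))
    (F' := fun x ω => deriv f (Y ω + x * η ω) * η ω)
    (x₀ := 0) (bound := fun _ => K * C) (Metric.ball_mem_nhds 0 (div_pos hc hC))
    (.of_forall fun x =>
      (hfm.comp_aemeasurable (hYm.add (hηm.const_mul x))).aestronglyMeasurable)
    (by simpa only [zero_mul, add_zero] using hfY)
    (((measurable_deriv f).comp_aemeasurable
      (hYm.add (hηm.const_mul 0))).mul hηm).aestronglyMeasurable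
    (ae_of_all _ fun ω x hx => hbound x hx ω) (integrable_const _)
    (ae_of_all _ fun ω x hx => hderiv x hx ω)).2

namespace IsPricingKernel

variable (hZ : IsPricingKernel m P Z)
include hZ

lemma add_const_mul_mem_budgetSet (hY : Y ∈ budgetSet m P Z) (hη : Measurable[m] η)
    (hi : Integrable (fun ω => Z ω * η ω) P) (h0 : ∫ ω, Z ω * η ω ∂P = 0) {x : ℝ}
    (hx : ∀ ω, 0 ≤ Y ω + x * η ω) : (fun ω => Y ω + x * η ω) ∈ budgetSet m P Z := by
  obtain ⟨hYm, -, hYi, hY1⟩ := hZ.mem_budgetSet_iff.1 hY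
  refine hZ.mem_budgetSet_iff.2 ⟨hYm.add (hη.const_mul x), hx, ?_, ?_⟩ <;>
    simp only [mul_add, mul_left_comm _ x]
  · exact hYi.add (hi.const_mul x)
  · rwa [integral_add hYi (hi.const_mul x), integral_const_mul, h0, mul_zero, add_zero]

variable [IsFiniteMeasure P] (hfm : Measurable f) (ha : 0 ≤ a) (hc : 0 < c)
  (hf : ∀ y, a < y → DifferentiableAt ℝ f y) (hY : Y ∈ budgetSet m P Z)
  (hfY : Integrable (fun ω => f (Y ω)) P)
  (hmax : IsMaxOn (fun Y => ∫ ω, f (Y ω) ∂P) (budgetSet m P Z) Y)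
include hfm ha hc hf hY hfY hmax

lemma integral_deriv_mul_eq_zero (hf' : ∀ y, a < y → |deriv f y| ≤ K)
    (hη : Measurable[m] η) (hC : 0 < C) (hηC : ∀ ω, |η ω| ≤ C)
    (hηY : ∀ ω, η ω ≠ 0 → a + c ≤ Y ω) (hi : Integrable (fun ω => Z ω * η ω) P)
    (h0 : ∫ ω, Z ω * η ω ∂P = 0) : ∫ ω, deriv f (Y ω) * η ω ∂P = 0 := by
  have hmem : ∀ x ∈ Metric.ball (0 : ℝ) (c / C), (fun ω => Y ω + x * η ω) ∈ budgetSet m P Z := by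
    refine fun x hx => hZ.add_const_mul_mem_budgetSet hY hη hi h0 fun ω => ?_
    by_cases hω : η ω = 0
    · simpa only [hω, mul_zero, add_zero] using hY.2.1 ω
    · exact ha.trans
        (lt_add_mul_of_abs_lt_div hC (mem_ball_zero_iff.1 hx) (hηC ω) (hηY ω hω)).le
  have hlocal : IsLocalMax (fun x => ∫ ω, f (Y ω + x * η ω) ∂P) 0 := by
    filter_upwards [Metric.ball_mem_nhds (0 : ℝ) (div_pos hc hC)] with x hx
    simpa only [zero_mul, add_zero, Set.mem_ofPred_eq] using hmax (hmem x hx)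
  exact hlocal.hasDerivAt_eq_zero (hasDerivAt_integral_comp_add_mul hfm hf hf'
    (hZ.aemeasurable_of_measurable hY.1) hfY (hZ.aemeasurable_of_measurable hη) hC hηC hc hηY)

lemma setIntegral_deriv_mul_eq_zero (hf' : ∀ y, a < y → |deriv f y| ≤ K)
    (hD : MeasurableSet[m] D) (hDY : ∀ ω ∈ D, a + c ≤ Y ω) (hη : Measurable[m] η)
    (hηC : ∀ ω ∈ D, |η ω| ≤ C) (hi : IntegrableOn (fun ω => Z ω * η ω) D P)
    (h0 : ∫ ω in D, Z ω * η ω ∂P = 0) : ∫ ω in D, deriv f (Y ω) * η ω ∂P = 0 := by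
  have hD' : NullMeasurableSet D P := hZ.nullMeasurableSet D hD
  have hi' : Integrable (fun ω => Z ω * D.indicator η ω) P :=
    (hi.integrable_indicator₀ hD').congr (ae_of_all _ fun ω => Set.indicator_mul_right D Z η)
  rw [← integral_indicator₀ hD'] at h0 ⊢
  simp only [Set.indicator_mul_right] at h0 ⊢
  refine hZ.integral_deriv_mul_eq_zero hfm ha hc hf hY hfY hmax hf' (hη.indicator hD)
    (lt_max_of_lt_right zero_lt_one : 0 < max C 1) (fun ω => ?_)
    (fun ω hω => hDY ω (Set.mem_of_indicator_ne_zero hω)) hi' h0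
  by_cases hω : ω ∈ D
  · rw [Set.indicator_of_mem hω]
    exact (hηC ω hω).trans (le_max_left _ _)
  · rw [Set.indicator_of_notMem hω, abs_zero]
    exact zero_le_one.trans (le_max_right _ _)

lemma exists_deriv_eq_const_mul (hf' : ∃ K, ∀ y, a < y → |deriv f y| ≤ K) (N : ℝ) :
    ∃ b : ℝ, ∀ᵐ ω ∂P, a + c ≤ Y ω ∧ Z ω ≤ N → deriv f (Y ω) = b * Z ω := by
  obtain ⟨K, hK⟩ := hf'
  set D : Set Ω := {ω | a + c ≤ Y ω ∧ Z ω ≤ N}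
  have hDm : MeasurableSet[m] D := (measurableSet_le measurable_const hY.1).inter
    (measurableSet_le hZ.measurable measurable_const)
  have hDn : NullMeasurableSet D P := hZ.nullMeasurableSet D hDm
  have hWm : Measurable[m] fun ω => deriv f (Y ω) := (measurable_deriv f).comp hY.1
  have hZN : ∀ ω ∈ D, |Z ω| ≤ N := fun ω hω => (abs_of_pos (hZ.pos ω)).trans_le hω.2
  have hWK : ∀ ω ∈ D, |deriv f (Y ω)| ≤ K := fun ω hω => hK _ (by linarith [hω.1])
  have memLp_two {X : Ω → ℝ} {M : ℝ} (hX : Measurable[m] X) (hM : ∀ ω ∈ D, |X ω| ≤ M) :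
      MemLp X 2 (P.restrict D) :=
    .of_bound (hZ.aemeasurable_of_measurable hX).restrict.aestronglyMeasurable M
      ((ae_restrict_iff'₀ hDn).2 (ae_of_all _ hM))
  have hZ2 : MemLp Z 2 (P.restrict D) := memLp_two hZ.measurable hZN
  by_cases hD0 : P D = 0
  · exact ⟨0, (measure_eq_zero_iff_ae_notMem.1 hD0).mono fun ω hω hωD => (hω hωD).elim⟩
  have hZZ : ∫ ω in D, Z ω * Z ω ∂P ≠ 0 := by
    refine ((integral_pos_iff_support_of_nonneg (fun ω => mul_self_nonneg (Z ω))
      (hZ2.integrable_mul hZ2)).2 ?_).ne'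
    rw [Function.support_eq_univ fun ω => (mul_pos (hZ.pos ω) (hZ.pos ω)).ne',
      Measure.restrict_apply_univ]
    exact pos_iff_ne_zero.2 hD0
  obtain ⟨b, hb⟩ := exists_ae_eq_const_mul_of_orthogonal (memLp_two hWm hWK) hZ2 hZZ fun b hb => by
    have hηm : Measurable[m] fun ω => deriv f (Y ω) - b * Z ω :=
      hWm.sub (hZ.measurable.const_mul b)
    have hηC : ∀ ω ∈ D, |deriv f (Y ω) - b * Z ω| ≤ K + |b| * N := fun ω hω =>
      (abs_sub _ _).trans (add_le_add (hWK ω hω) ((abs_mul _ _).trans_le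
        (mul_le_mul_of_nonneg_left (hZN ω hω) (abs_nonneg b))))
    exact hZ.setIntegral_deriv_mul_eq_zero hfm ha hc hf hY hfY hmax hK hDm (fun ω hω => hω.1)
      hηm hηC (hZ2.integrable_mul (memLp_two hηm hηC)) hb
  exact ⟨b, (ae_restrict_iff'₀ hDn).1 hb⟩

end IsPricingKernel

end FirstOrder

section Slices

lemma continuous_measureReal_Iic (ν : Measure ℝ) [IsFiniteMeasure ν] [NullSingletonClass ν] :
    Continuous fun t => ν.real (Set.Iic t) := by
  have h (t : ℝ) : ν.real (Set.Iic t) = ν.real (Set.Iic 0) + ∫ _ in (0 : ℝ)..t, (1 : ℝ) ∂ν := by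
    rw [← intervalIntegral.integral_Iic_sub_Iic (integrable_const _).integrableOn
      (integrable_const _).integrableOn]
    simp only [setIntegral_const, smul_eq_mul, mul_one, add_sub_cancel]
  rw [funext h]
  exact continuous_const.add
    (intervalIntegral.continuous_primitive (fun _ _ => intervalIntegrable_const) 0)

lemma exists_measureReal_Iic_eq {ν : Measure ℝ} [IsFiniteMeasure ν] [NullSingletonClass ν]
    {c : ℝ} (hc0 : 0 < c) (hc : c < ν.real Set.univ) : ∃ t, ν.real (Set.Iic t) = c := by
  have hempty : ⋂ t : ℝ, Set.Iic t = ∅ := iInter_Iic_eq_empty_iff.2 fun h =>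
    (not_bddBelow_univ (α := ℝ)) (Set.range_id (α := ℝ) ▸ h)
  have hbot : Filter.Tendsto (fun t => ν.real (Set.Iic t)) Filter.atBot (nhds 0) := by
    have := (ENNReal.tendsto_toReal (measure_ne_top ν _)).comp (tendsto_measure_iInter_atBot
      (fun t : ℝ => measurableSet_Iic.nullMeasurableSet (s := Set.Iic t) (μ := ν))
      (fun _ _ h => Set.Iic_subset_Iic.2 h) ⟨0, measure_ne_top ν _⟩)
    rwa [hempty, measure_empty, ENNReal.toReal_zero] at this
  have htop : Filter.Tendsto (fun t => ν.real (Set.Iic t)) Filter.atTop (nhds (ν.real Set.univ)) :=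
    (ENNReal.tendsto_toReal (measure_ne_top ν _)).comp (tendsto_measure_Iic_atTop ν)
  exact mem_range_of_exists_le_of_exists_ge (continuous_measureReal_Iic ν)
    (hbot.eventually_le_const hc0).exists (htop.eventually_const_le hc).exists

lemma exists_measureReal_inter_Iic_eq {Ω : Type*} [MeasurableSpace Ω] {P : Measure Ω}
    [IsFiniteMeasure P] {X : Ω → ℝ} (hX : AEMeasurable X P) (hatom : ∀ x, P (X ⁻¹' {x}) = 0)
    {C : Set Ω} {c : ℝ} (hc0 : 0 < c) (hc : c < P.real C) :
    ∃ t, P.real (C ∩ X ⁻¹' Set.Iic t) = c := by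
  have hX' : AEMeasurable X (P.restrict C) := hX.restrict
  have hmap {s : Set ℝ} (hs : MeasurableSet s) :
      ((P.restrict C).map X).real s = P.real (C ∩ X ⁻¹' s) := by
    rw [measureReal_def, Measure.map_apply_of_aemeasurable hX' hs,
      Measure.restrict_apply₀ (hX'.nullMeasurableSet_preimage hs), Set.inter_comm, measureReal_def]
  have : NullSingletonClass ((P.restrict C).map X) := ⟨fun x => by
    rw [Measure.map_apply_of_aemeasurable hX' (measurableSet_singleton x)]
    exact Measure.absolutelyContinuous_of_le Measure.restrict_le_self (hatom x)⟩
  obtain ⟨t, ht⟩ := exists_measureReal_Iic_eq (ν := (P.restrict C).map X) hc0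
    (by rwa [hmap .univ, Set.preimage_univ, Set.inter_univ])
  exact ⟨t, (hmap measurableSet_Iic).symm.trans ht⟩

end Slices

section Transfer

variable {Ω : Type*} {m : MeasurableSpace Ω} [mΩ : MeasurableSpace Ω] {P : Measure Ω}
  {Y Z : Ω → ℝ} {A C : Set Ω} {f : ℝ → ℝ} {b ε y₀ : ℝ}

/-- The claim `Y` after giving up its payoff on `C` and replacing it by the constant `y₀` on `A`,
with priority to `A` where the two events overlap. -/
noncomputable def transfer (A C : Set Ω) (y₀ : ℝ) (Y : Ω → ℝ) : Ω → ℝ :=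
  open Classical in A.piecewise (fun _ => y₀) (C.piecewise (fun _ => 0) Y)

namespace IsPricingKernel

variable (hZ : IsPricingKernel m P Z)
include hZ

lemma transfer_mem_budgetSet [IsFiniteMeasure P] (hY : Y ∈ budgetSet m P Z)
    (hA : MeasurableSet[m] A) (hC : MeasurableSet[m] C) (hAε : ∀ ω ∈ A, Z ω ≤ ε) (hy₀ : 0 ≤ y₀)
    (hbudget : y₀ * ε * P.real A + ∫ ω in Cᶜ, Z ω * Y ω ∂P ≤ 1) :
    transfer A C y₀ Y ∈ budgetSet m P Z := by
  classical
  obtain ⟨hYm, hY0, hYi, -⟩ := hZ.mem_budgetSet_iff.1 hY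
  have hA' := hZ.nullMeasurableSet A hA
  have hC' := hZ.nullMeasurableSet _ hC.compl
  have hm : Measurable[m] (transfer A C y₀ Y) :=
    measurable_const.piecewise hA (measurable_const.piecewise hC hYm)
  have h0 (ω : Ω) : 0 ≤ transfer A C y₀ Y ω := by
    unfold transfer Set.piecewise
    split_ifs
    exacts [hy₀, le_rfl, hY0 ω]
  have hiA : Integrable (A.indicator fun _ => y₀ * ε) P :=
    (integrable_const (y₀ * ε)).integrableOn.integrable_indicator₀ hA'
  have hiC : Integrable (Cᶜ.indicator fun ω => Z ω * Y ω) P :=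
    hYi.integrableOn.integrable_indicator₀ hC'
  have hle (ω : Ω) : Z ω * transfer A C y₀ Y ω
      ≤ A.indicator (fun _ => y₀ * ε) ω + Cᶜ.indicator (fun ω => Z ω * Y ω) ω := by
    have hZY := mul_nonneg (hZ.pos ω).le (hY0 ω)
    by_cases hωA : ω ∈ A
    · have := mul_le_mul_of_nonneg_right (hAε ω hωA) hy₀
      by_cases hωC : ω ∈ C <;>
        simp only [transfer, Set.piecewise, Set.indicator, Set.mem_compl_iff, hωA, hωC,
          not_true_eq_false, not_false_eq_true, ↓reduceIte] <;> linarith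
    · by_cases hωC : ω ∈ C <;> simp [transfer, hωA, hωC]
  have hi : Integrable (fun ω => Z ω * transfer A C y₀ Y ω) P :=
    (hiA.add hiC).mono' (hZ.aemeasurable_of_measurable (hZ.measurable.mul hm)).aestronglyMeasurable
      (ae_of_all _ fun ω =>
        (Real.norm_of_nonneg (mul_nonneg (hZ.pos ω).le (h0 ω))).trans_le (hle ω))
  refine hZ.mem_budgetSet_iff.2 ⟨hm, h0, hi, (integral_mono hi (hiA.add hiC) hle).trans ?_⟩
  rw [integral_add' hiA hiC, integral_indicator₀ hA', integral_indicator₀ hC', setIntegral_const,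
    smul_eq_mul, mul_comm (P.real A)]
  exact hbudget

lemma sub_mul_measureReal_le_of_transfer_mem [IsFiniteMeasure P]
    (hfi : ∀ Y ∈ budgetSet m P Z, Integrable (fun ω => f (Y ω)) P) (hY : Y ∈ budgetSet m P Z)
    (hmax : IsMaxOn (fun Y => ∫ ω, f (Y ω) ∂P) (budgetSet m P Z) Y)
    (hA : MeasurableSet[m] A) (hC : MeasurableSet[m] C)
    (hY' : transfer A C y₀ Y ∈ budgetSet m P Z) (hfb : ∀ᵐ ω ∂P, f (Y ω) ≤ b) (hf0 : f 0 ≤ b) :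
    (f y₀ - b) * P.real A ≤ (b - f 0) * P.real C := by
  classical
  have hA' := hZ.nullMeasurableSet A hA
  have hC' := hZ.nullMeasurableSet C hC
  have hiA : Integrable (A.indicator fun _ => f y₀ - b) P :=
    (integrable_const (f y₀ - b)).integrableOn.integrable_indicator₀ hA'
  have hiC : Integrable (C.indicator fun _ => b - f 0) P :=
    (integrable_const (b - f 0)).integrableOn.integrable_indicator₀ hC'
  have hle : ∀ᵐ ω ∂P, f (Y ω) + A.indicator (fun _ => f y₀ - b) ω
      ≤ f (transfer A C y₀ Y ω) + C.indicator (fun _ => b - f 0) ω := by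
    filter_upwards [hfb] with ω hω
    by_cases hωA : ω ∈ A <;> by_cases hωC : ω ∈ C <;>
      simp only [transfer, Set.piecewise, Set.indicator, hωA, hωC, ↓reduceIte] <;> linarith
  have hint := integral_mono_ae ((hfi Y hY).add hiA) ((hfi _ hY').add hiC) hle
  have hopt : ∫ ω, f (transfer A C y₀ Y ω) ∂P ≤ ∫ ω, f (Y ω) ∂P := hmax hY'
  rw [integral_add' (hfi Y hY) hiA, integral_add' (hfi _ hY') hiC, integral_indicator₀ hA',
    integral_indicator₀ hC', setIntegral_const, setIntegral_const, smul_eq_mul, smul_eq_mul] at hint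
  linarith

/-- A small amount `q` can be raised by giving up the claim on an event of probability at most `q`:
either the budget has slack, or the event is cut out of the states where `Z * Y` is at least its
mean. -/
lemma exists_forall_exists_measureReal_le [IsProbabilityMeasure P]
    (hatom : ∀ z, P (Z ⁻¹' {z}) = 0) (hY : Y ∈ budgetSet m P Z) :
    ∃ q₀ : ℝ, 0 < q₀ ∧ ∀ q ∈ Set.Ioo 0 q₀, ∃ C, MeasurableSet[m] C ∧ P.real C ≤ q ∧
      q + ∫ ω in Cᶜ, Z ω * Y ω ∂P ≤ 1 := by
  obtain ⟨hYm, -, hYi, hY1⟩ := hZ.mem_budgetSet_iff.1 hY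
  rcases hY1.lt_or_eq with hslack | htight
  · refine ⟨1 - ∫ ω, Z ω * Y ω ∂P, sub_pos.2 hslack, fun q hq =>
      ⟨∅, @MeasurableSet.empty Ω m, ?_, ?_⟩⟩
    · rw [measureReal_empty]
      exact hq.1.le
    · rw [Set.compl_empty, setIntegral_univ]
      linarith [hq.2]
  set S : Set Ω := {ω | 1 ≤ Z ω * Y ω}
  have hS : 0 < P.real S := by
    have := measure_integral_le_pos hYi
    rw [htight] at this
    exact ENNReal.toReal_pos this.ne' (measure_ne_top P S)
  refine ⟨P.real S, hS, fun q hq => ?_⟩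
  obtain ⟨t, ht⟩ := exists_measureReal_inter_Iic_eq
    (hZ.aemeasurable_of_measurable hZ.measurable) hatom hq.1 hq.2
  set C : Set Ω := S ∩ Z ⁻¹' Set.Iic t
  have hC : MeasurableSet[m] C :=
    (measurableSet_le measurable_const (hZ.measurable.mul hYm)).inter
      (hZ.measurable measurableSet_Iic)
  refine ⟨C, hC, ht.le, ?_⟩
  have hraise : q ≤ ∫ ω in C, Z ω * Y ω ∂P := by
    have := setIntegral_mono_on₀ (integrable_const (1 : ℝ)).integrableOn hYi.integrableOn
      (hZ.nullMeasurableSet C hC) (fun ω hω => hω.1)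
    rwa [setIntegral_const, smul_eq_mul, mul_one, ht] at this
  have hsplit := integral_add_compl₀ (hZ.nullMeasurableSet C hC) hYi
  linarith

lemma not_ae_le_of_isMaxOn [IsProbabilityMeasure P] {γ : ℝ}
    (hatom : ∀ z, P (Z ⁻¹' {z}) = 0) (hcheap : ∀ ε > 0, P {ω | Z ω < ε} ≠ 0)
    (hfi : ∀ Y ∈ budgetSet m P Z, Integrable (fun ω => f (Y ω)) P) (hγ : 0 ≤ γ)
    (hfb : ∀ y ∈ Set.Icc 0 γ, f y ≤ b) (hy₀ : 0 < y₀) (hby₀ : b < f y₀)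
    (hY : Y ∈ budgetSet m P Z)
    (hmax : IsMaxOn (fun Y => ∫ ω, f (Y ω) ∂P) (budgetSet m P Z) Y) :
    ¬ ∀ᵐ ω ∂P, Y ω ≤ γ := by
  intro hYγ
  have hf0 : f 0 ≤ b := hfb 0 ⟨le_rfl, hγ⟩
  obtain ⟨q₀, hq₀, hraise⟩ := hZ.exists_forall_exists_measureReal_le hatom hY
  obtain ⟨x, hx0, hx⟩ : ∃ x > 0, x < q₀ ∧ (b - f 0) * x < f y₀ - b := by
    have hev : ∀ᶠ x in nhds (0 : ℝ), x < q₀ ∧ (b - f 0) * x < f y₀ - b := by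
      refine (eventually_lt_nhds hq₀).and ((ContinuousAt.eventually_lt (by fun_prop)
        continuousAt_const ?_))
      rw [mul_zero]
      exact sub_pos.2 hby₀
    exact hev.exists_gt
  set A : Set Ω := {ω | Z ω < x / y₀}
  have hA : MeasurableSet[m] A := measurableSet_lt hZ.measurable measurable_const
  have hPA : 0 < P.real A :=
    ENNReal.toReal_pos (hcheap _ (div_pos hx0 hy₀)) (measure_ne_top P A)
  have hxA : x * P.real A ∈ Set.Ioo 0 q₀ :=
    ⟨mul_pos hx0 hPA, (mul_le_of_le_one_right hx0.le measureReal_le_one).trans_lt hx.1⟩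
  obtain ⟨C, hC, hPC, hbudget⟩ := hraise _ hxA
  have hY' : transfer A C y₀ Y ∈ budgetSet m P Z :=
    hZ.transfer_mem_budgetSet hY hA hC (fun ω hω => le_of_lt hω) hy₀.le
      (by rwa [mul_div_cancel₀ _ hy₀.ne'])
  have hgain := hZ.sub_mul_measureReal_le_of_transfer_mem hfi hY hmax hA hC hY'
    (hYγ.mono fun ω hω => hfb _ ⟨hY.2.1 ω, hω⟩) hf0
  have hloss : (b - f 0) * P.real C < (f y₀ - b) * P.real A := calc
    (b - f 0) * P.real C ≤ (b - f 0) * (x * P.real A) :=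
      mul_le_mul_of_nonneg_left hPC (sub_nonneg.2 hf0)
    _ = (b - f 0) * x * P.real A := (mul_assoc _ _ _).symm
    _ < (f y₀ - b) * P.real A := mul_lt_mul_of_pos_right hx.2 hPA
  exact hgain.not_gt hloss

end IsPricingKernel

end Transfer

namespace Params

section Utility

variable {p : Params} {y θ : ℝ}

lemma measurable_U : Measurable p.U := by
  unfold Params.U
  exact .ite measurableSet_Ici (by fun_prop) (by fun_prop)

lemma measurable_F (θ : ℝ) : Measurable fun y => p.F y θ :=
  (measurable_U.comp (measurable_id.sub_const _)).add ((measurable_id.pow_const _).const_mul _)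

lemma F_of_le (h : p.γ ≤ y) : p.F y θ = (y - p.γ) ^ p.α + θ * y ^ p.α := by
  rw [F, U, if_pos (sub_nonneg.2 h)]

lemma F_of_lt (h : y < p.γ) : p.F y θ = -p.k * (p.γ - y) ^ p.α + θ * y ^ p.α := by
  rw [F, U, if_neg (not_le.2 (sub_neg.2 h)), abs_of_neg (sub_neg.2 h), neg_sub]

lemma F_mono (hy : 0 ≤ y) : Monotone (p.F y) := fun _ _ h =>
  (add_le_add_iff_left _).2 (mul_le_mul_of_nonneg_right h (Real.rpow_nonneg hy _))

namespace Standing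

variable (hp : p.Standing)
include hp

lemma F_le_max (hy : y ∈ Set.Icc 0 p.γ) : p.F y θ ≤ max (-p.k) θ * p.γ ^ p.α := by
  have hy' : 0 ≤ p.γ - y := sub_nonneg.2 hy.2
  have hF : p.F y θ = -p.k * (p.γ - y) ^ p.α + θ * y ^ p.α := by
    rcases hy.2.eq_or_lt with rfl | h
    · rw [F_of_le le_rfl, sub_self, Real.zero_rpow hp.α_pos.ne', mul_zero]
    · exact F_of_lt h
  have hloss : 0 ≤ (p.γ - y) ^ p.α := Real.rpow_nonneg hy' _
  have hgain : 0 ≤ y ^ p.α := Real.rpow_nonneg hy.1 _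
  rw [hF]
  rcases le_total 0 θ with hθ | hθ
  · rw [max_eq_right ((neg_nonpos.2 hp.k_nonneg).trans hθ)]
    have h1 : 0 ≤ p.k * (p.γ - y) ^ p.α := mul_nonneg hp.k_nonneg hloss
    have h2 : θ * y ^ p.α ≤ θ * p.γ ^ p.α :=
      mul_le_mul_of_nonneg_left (Real.rpow_le_rpow hy.1 hy.2 hp.α_pos.le) hθ
    linarith
  · calc -p.k * (p.γ - y) ^ p.α + θ * y ^ p.α
        ≤ max (-p.k) θ * (p.γ - y) ^ p.α + max (-p.k) θ * y ^ p.α := by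
          gcongr
          exacts [le_max_left _ _, le_max_right _ _]
      _ = max (-p.k) θ * ((p.γ - y) ^ p.α + y ^ p.α) := (mul_add _ _ _).symm
      _ ≤ max (-p.k) θ * p.γ ^ p.α := by
          refine mul_le_mul_of_nonpos_left ?_ (max_le (neg_nonpos.2 hp.k_nonneg) hθ)
          simpa only [sub_add_cancel] using
            Real.rpow_add_le_add_rpow hy' hy.1 hp.α_pos.le hp.α_lt_one.le

/-- At the weight `-m ^ (1 - α)`, the return `γ m / (m - 1)` maximizes `F` above the benchmark. -/
lemma F_mul_div_sub_one {m : ℝ} (hm : 1 < m) :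
    p.F (p.γ * (m / (m - 1))) (-m ^ (1 - p.α)) = -(m - 1) ^ (1 - p.α) * p.γ ^ p.α := by
  have hγ := hp.γ_pos
  have hm0 : 0 < m := one_pos.trans hm
  have hm1 : 0 < m - 1 := sub_pos.2 hm
  have hle : p.γ ≤ p.γ * (m / (m - 1)) :=
    le_mul_of_one_le_right hγ.le ((one_le_div hm1).2 (sub_le_self m zero_le_one))
  have hexcess : p.γ * (m / (m - 1)) - p.γ = p.γ / (m - 1) := by
    field_simp
    ring
  have h1 := (Real.rpow_pos_of_pos hm0 p.α).ne'
  have h2 := (Real.rpow_pos_of_pos hm1 p.α).ne'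
  rw [F_of_le hle, hexcess, Real.div_rpow hγ.le hm1.le, Real.mul_rpow hγ.le (by positivity),
    Real.div_rpow hm0.le hm1.le, Real.rpow_sub hm0, Real.rpow_sub hm1, Real.rpow_one, Real.rpow_one]
  field_simp
  ring

lemma tendsto_F_atTop (hθ : -1 < θ) :
    Filter.Tendsto (fun y => p.F y θ) Filter.atTop Filter.atTop := by
  have hpow : Filter.Tendsto (fun y : ℝ => (1 + θ) * y ^ p.α - p.γ ^ p.α) .atTop .atTop :=
    Filter.tendsto_atTop_add_const_right _ _
      ((tendsto_rpow_atTop hp.α_pos).const_mul_atTop (neg_lt_iff_pos_add'.1 hθ))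
  refine Filter.tendsto_atTop_mono' _ ?_ hpow
  filter_upwards [Filter.eventually_ge_atTop p.γ] with y hy
  have hsub := Real.rpow_add_le_add_rpow (sub_nonneg.2 hy) hp.γ_pos.le hp.α_pos.le hp.α_lt_one.le
  rw [sub_add_cancel] at hsub
  rw [F_of_le hy]
  linarith

lemma exists_one_lt_of_thetaLow_lt (hθ : p.thetaLow < θ) (hθ1 : θ ≤ -1) :
    ∃ m, 1 < m ∧ -m ^ (1 - p.α) ≤ θ ∧ max (-p.k) θ < -(m - 1) ^ (1 - p.α) := by
  have hα : 0 < 1 - p.α := sub_pos.2 hp.α_lt_one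
  have hq : 0 ≤ p.k ^ (1 - p.α)⁻¹ := Real.rpow_nonneg hp.k_nonneg _
  set s := (-θ) ^ (1 - p.α)⁻¹ with hs
  have hθ0 : 0 ≤ -θ := by linarith
  have hs1 : 1 ≤ s := Real.one_le_rpow (by linarith) (inv_pos.2 hα).le
  have hsq : s < 1 + p.k ^ (1 - p.α)⁻¹ := by
    rw [hs, Real.rpow_inv_lt_iff_of_pos hθ0 (by positivity) hα]
    rw [thetaLow, one_div] at hθ
    exact neg_lt.1 hθ
  obtain ⟨m, hsm, hm⟩ := exists_between (lt_min hsq (lt_one_add s))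
  have hm1 : 1 < m := hs1.trans_lt hsm
  have hm0 : 0 ≤ m - 1 := (sub_pos.2 hm1).le
  rw [lt_min_iff, ← sub_lt_iff_lt_add', ← sub_lt_iff_lt_add',
    Real.lt_rpow_inv_iff_of_pos hm0 hp.k_nonneg hα, hs,
    Real.lt_rpow_inv_iff_of_pos hm0 hθ0 hα] at hm
  rw [hs, Real.rpow_inv_lt_iff_of_pos hθ0 (one_pos.trans hm1).le hα] at hsm
  exact ⟨m, hm1, (neg_lt.1 hsm).le, max_lt (neg_lt_neg hm.1) (lt_neg.1 hm.2)⟩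

lemma exists_lt_F_of_thetaLow_lt (hθ : p.thetaLow < θ) :
    ∃ y₀ > 0, max (-p.k) θ * p.γ ^ p.α < p.F y₀ θ := by
  rcases lt_or_ge (-1) θ with hθ1 | hθ1
  · exact ((Filter.eventually_gt_atTop 0).and
      ((hp.tendsto_F_atTop hθ1).eventually_gt_atTop _)).exists
  obtain ⟨m, hm, hmθ, hmax⟩ := hp.exists_one_lt_of_thetaLow_lt hθ hθ1
  have hy₀ : 0 < p.γ * (m / (m - 1)) :=
    mul_pos hp.γ_pos (div_pos (one_pos.trans hm) (sub_pos.2 hm))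
  refine ⟨_, hy₀, ?_⟩
  calc max (-p.k) θ * p.γ ^ p.α
      < -(m - 1) ^ (1 - p.α) * p.γ ^ p.α :=
        mul_lt_mul_of_pos_right hmax (Real.rpow_pos_of_pos hp.γ_pos _)
    _ = p.F (p.γ * (m / (m - 1))) (-m ^ (1 - p.α)) := (hp.F_mul_div_sub_one hm).symm
    _ ≤ p.F (p.γ * (m / (m - 1))) θ := F_mono hy₀.le hmθ

lemma abs_U_le (hy : 0 ≤ y) : |p.U (y - p.γ)| ≤ (1 + p.k) * (y ^ p.α + p.γ ^ p.α) := by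
  have hpow : |y - p.γ| ^ p.α ≤ y ^ p.α + p.γ ^ p.α := by
    refine (Real.rpow_le_rpow (abs_nonneg _) ?_ hp.α_pos.le).trans
      (Real.rpow_add_le_add_rpow hy hp.γ_pos.le hp.α_pos.le hp.α_lt_one.le)
    exact abs_le.2 ⟨by linarith, by linarith [hp.γ_pos]⟩
  have hpow0 : 0 ≤ |y - p.γ| ^ p.α := Real.rpow_nonneg (abs_nonneg _) _
  have hU : |p.U (y - p.γ)| ≤ (1 + p.k) * |y - p.γ| ^ p.α := by
    unfold U
    split_ifs with h
    · rw [abs_of_nonneg h] at hpow0 ⊢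
      rw [abs_of_nonneg hpow0]
      exact le_mul_of_one_le_left hpow0 (le_add_of_nonneg_right hp.k_nonneg)
    · rw [neg_mul, abs_neg, abs_mul, abs_of_nonneg hp.k_nonneg, abs_of_nonneg hpow0]
      exact mul_le_mul_of_nonneg_right (le_add_of_nonneg_left zero_le_one) hpow0
  exact hU.trans (mul_le_mul_of_nonneg_left hpow (add_nonneg zero_le_one hp.k_nonneg))

lemma abs_F_le (hy : 0 ≤ y) : |p.F y θ| ≤ (1 + p.k + |θ|) * (y ^ p.α + p.γ ^ p.α) := by
  have hpow : |θ * y ^ p.α| ≤ |θ| * (y ^ p.α + p.γ ^ p.α) := by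
    rw [abs_mul, abs_of_nonneg (Real.rpow_nonneg hy _)]
    exact mul_le_mul_of_nonneg_left
      (le_add_of_nonneg_right (Real.rpow_nonneg hp.γ_pos.le _)) (abs_nonneg θ)
  rw [F, add_mul]
  exact (abs_add_le _ _).trans (add_le_add (hp.abs_U_le hy) hpow)

lemma hasDerivAt_F (hy : p.γ < y) : HasDerivAt (fun y => p.F y θ)
    (p.α * ((y - p.γ) ^ (p.α - 1) + θ * y ^ (p.α - 1))) y := by
  have h1 : HasDerivAt (fun x : ℝ => (x - p.γ) ^ p.α) (1 * p.α * (y - p.γ) ^ (p.α - 1)) y :=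
    ((hasDerivAt_id y).sub_const p.γ).rpow_const (.inl (sub_pos.2 hy).ne')
  have h2 : HasDerivAt (fun x : ℝ => x ^ p.α) (p.α * y ^ (p.α - 1)) y :=
    Real.hasDerivAt_rpow_const (.inl (hp.γ_pos.trans hy).ne')
  refine ((h1.add (h2.const_mul θ)).congr_of_eventuallyEq ?_).congr_deriv (by ring)
  filter_upwards [lt_mem_nhds hy] with x hx
  exact F_of_le hx.le

lemma abs_deriv_F_le {c : ℝ} (hc : 0 < c) (hy : p.γ + c < y) :
    |deriv (fun y => p.F y θ) y| ≤ p.α * (c ^ (p.α - 1) + |θ| * p.γ ^ (p.α - 1)) := by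
  have hα : p.α - 1 ≤ 0 := (sub_neg.2 hp.α_lt_one).le
  have hγ := hp.γ_pos
  have h1 : (y - p.γ) ^ (p.α - 1) ≤ c ^ (p.α - 1) :=
    Real.rpow_le_rpow_of_nonpos hc (by linarith) hα
  have h2 : y ^ (p.α - 1) ≤ p.γ ^ (p.α - 1) := Real.rpow_le_rpow_of_nonpos hγ (by linarith) hα
  rw [(hp.hasDerivAt_F (by linarith)).deriv, abs_mul, abs_of_pos hp.α_pos]
  refine mul_le_mul_of_nonneg_left ((abs_add_le _ _).trans (add_le_add ?_ ?_)) hp.α_pos.le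
  · rwa [abs_of_nonneg (Real.rpow_nonneg (by linarith) _)]
  · rw [abs_mul, abs_of_nonneg (Real.rpow_nonneg (by linarith) _)]
    exact mul_le_mul_of_nonneg_left h2 (abs_nonneg θ)

/-- Two weights with marginal utilities proportional to `z` make `z` proportional both to
`y ^ (α - 1)` and to `(y - γ) ^ (α - 1)`, and the quotient of these two powers determines `y`. -/
lemma eq_of_deriv_F_eq_mul {θ θ' b b' y₁ y₂ z₁ z₂ : ℝ} (hθ : θ ≠ θ') (hy₁ : p.γ < y₁)
    (hy₂ : p.γ < y₂) (hz₁ : z₁ ≠ 0)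
    (h₁ : deriv (fun y => p.F y θ) y₁ = b * z₁) (h₁' : deriv (fun y => p.F y θ') y₁ = b' * z₁)
    (h₂ : deriv (fun y => p.F y θ) y₂ = b * z₂) (h₂' : deriv (fun y => p.F y θ') y₂ = b' * z₂) :
    z₁ = z₂ := by
  rw [(hp.hasDerivAt_F ‹_›).deriv] at h₁ h₁' h₂ h₂'
  have hγ := hp.γ_pos
  have hy₁0 : 0 < y₁ := hγ.trans hy₁
  have hy₂0 : 0 < y₂ := hγ.trans hy₂
  have hα : p.α * (θ - θ') ≠ 0 := mul_ne_zero hp.α_pos.ne' (sub_ne_zero.2 hθ)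
  have hw : y₁ ^ (p.α - 1) * z₂ = y₂ ^ (p.α - 1) * z₁ :=
    mul_left_cancel₀ hα (by linear_combination z₂ * (h₁ - h₁') - z₁ * (h₂ - h₂'))
  have hv : (y₁ - p.γ) ^ (p.α - 1) * z₂ = (y₂ - p.γ) ^ (p.α - 1) * z₁ :=
    mul_left_cancel₀ hp.α_pos.ne' (by linear_combination z₂ * h₁ - z₁ * h₂ - p.α * θ * hw)
  have hvw : ((y₁ - p.γ) * y₂) ^ (p.α - 1) = ((y₂ - p.γ) * y₁) ^ (p.α - 1) := by
    rw [Real.mul_rpow (sub_pos.2 hy₁).le hy₂0.le, Real.mul_rpow (sub_pos.2 hy₂).le hy₁0.le]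
    refine mul_right_cancel₀ hz₁ ?_
    linear_combination y₁ ^ (p.α - 1) * hv - (y₁ - p.γ) ^ (p.α - 1) * hw
  have hy := Real.rpow_left_injOn (sub_neg.2 hp.α_lt_one).ne
    (mul_pos (sub_pos.2 hy₁) hy₂0).le (mul_pos (sub_pos.2 hy₂) hy₁0).le hvw
  obtain rfl : y₁ = y₂ := mul_left_cancel₀ hγ.ne' (by linear_combination hy)
  exact (mul_left_cancel₀ (Real.rpow_pos_of_pos hy₁0 _).ne' hw).symm

end Standing

end Utility

end Params

section Market

variable {Ω : Type*} [MeasurableSpace Ω] {P : Measure Ω} {B : ℝ≥0 → Ω → ℝ} {t : ℝ≥0} {p : Params}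

lemma nullMeasurableSet_of_measurableSet_augmentedSigma (hB : ∀ s, AEMeasurable (B s) P)
    (t : ℝ≥0) {s : Set Ω} (hs : MeasurableSet[augmentedSigma P B t] s) :
    NullMeasurableSet s P := by
  have hle : augmentedSigma P B t
      ≤ (inferInstance : MeasurableSpace (NullMeasurableSpace Ω P)) := by
    refine sup_le (iSup_le fun u => ?_)
      (MeasurableSpace.generateFrom_le fun N hN => NullMeasurableSet.of_null hN)
    exact measurable_iff_comap_le.1 (hB u).nullMeasurable
  exact hle s hs

lemma measurable_augmentedSigma (t : ℝ≥0) : Measurable[augmentedSigma P B t] (B t) :=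
  measurable_iff_comap_le.2 <| le_sup_of_le_left <|
    le_iSup (fun s : Set.Iic t => MeasurableSpace.comap (B s) inferInstance)
      ⟨t, Set.self_mem_Iic⟩

lemma isPricingKernel_kernelZ (hB : IsPreBrownianReal B P) (p : Params) (t : ℝ≥0) :
    IsPricingKernel (augmentedSigma P B t) P (kernelZ p B t) where
  nullMeasurableSet _ := nullMeasurableSet_of_measurableSet_augmentedSigma hB.aemeasurable t
  measurable := Real.measurable_exp.comp
    (((measurable_augmentedSigma t).const_mul _).sub_const _)
  pos _ := Real.exp_pos _

lemma measure_preimage_kernelZ_singleton (hB : IsPreBrownianReal B P) (hφ : p.φ ≠ 0)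
    (ht : t ≠ 0) (z : ℝ) : P (kernelZ p B t ⁻¹' {z}) = 0 := by
  have hlaw := hB.hasLaw_eval t
  have := nullSingletonClass_gaussianReal (μ := 0) ht
  set x := (Real.log z + (p.r + p.φ ^ 2 / 2) * t) / (-p.φ) with hx
  have hBx : P (B t ⁻¹' {x}) = 0 := by
    rw [← Measure.map_apply_of_aemeasurable hlaw.aemeasurable (measurableSet_singleton x),
      hlaw.map_eq, measure_singleton]
  refine measure_mono_null (fun ω hω => ?_) hBx
  rw [Set.mem_preimage, Set.mem_singleton_iff] at hω ⊢
  rw [hx, ← hω, kernelZ, Real.log_exp, sub_add_cancel, mul_div_cancel_left₀ _ (neg_ne_zero.2 hφ)]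

lemma measure_kernelZ_lt_ne_zero (hB : IsPreBrownianReal B P) (hφ : p.φ ≠ 0) (ht : t ≠ 0)
    {ε : ℝ} (hε : 0 < ε) : P {ω | kernelZ p B t ω < ε} ≠ 0 := by
  have hlaw := hB.hasLaw_eval t
  set g : ℝ → ℝ := fun x => Real.exp (-p.φ * x - (p.r + p.φ ^ 2 / 2) * t)
  have ho : IsOpen (g ⁻¹' Set.Iio ε) := isOpen_Iio.preimage (by fun_prop)
  have hne : (g ⁻¹' Set.Iio ε).Nonempty := by
    refine ⟨(Real.log ε - 1 + (p.r + p.φ ^ 2 / 2) * t) / (-p.φ), ?_⟩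
    simp only [g, Set.mem_preimage, Set.mem_Iio]
    rw [mul_div_cancel₀ _ (neg_ne_zero.2 hφ), add_sub_cancel_right, ← Real.lt_log_iff_exp_lt hε]
    exact sub_one_lt _
  change P (B t ⁻¹' (g ⁻¹' Set.Iio ε)) ≠ 0
  rw [← Measure.map_apply_of_aemeasurable hlaw.aemeasurable ho.measurableSet, hlaw.map_eq]
  exact fun h0 => ho.measure_ne_zero volume hne (gaussianReal_absolutelyContinuous' 0 ht h0)

lemma lintegral_kernelZ_rpow (hB : IsPreBrownianReal B P) (p : Params) (t : ℝ≥0) (q : ℝ) :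
    ∫⁻ ω, ENNReal.ofReal (kernelZ p B t ω ^ q) ∂P
      = ENNReal.ofReal (Real.exp ((q * (q - 1) * (p.φ ^ 2 / 2) - q * p.r) * t)) := by
  have hlaw := hB.hasLaw_eval t
  have hexp (ω : Ω) : kernelZ p B t ω ^ q
      = Real.exp (-(q * (p.r + p.φ ^ 2 / 2) * t)) * Real.exp (-(q * p.φ) * B t ω) := by
    rw [kernelZ, ← Real.exp_mul, ← Real.exp_add]
    ring_nf
  have hint : Integrable (fun ω => Real.exp (-(q * p.φ) * B t ω)) P := by
    have h := integrable_exp_mul_gaussianReal (μ := 0) (v := t) (-(q * p.φ))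
    rw [← hlaw.map_eq] at h
    exact h.comp_aemeasurable hlaw.aemeasurable
  have hmgf : ∫ ω, Real.exp (-(q * p.φ) * B t ω) ∂P
      = Real.exp (0 * -(q * p.φ) + t * (-(q * p.φ)) ^ 2 / 2) :=
    mgf_gaussianReal hlaw.map_eq _
  simp only [hexp]
  rw [← ofReal_integral_eq_lintegral_ofReal (hint.const_mul _) (ae_of_all _ fun ω => by positivity),
    integral_const_mul, hmgf, ← Real.exp_add]
  ring_nf

variable {Y : Ω → ℝ}

namespace Params.Standing

variable (hp : p.Standing)
include hp

lemma lintegral_rpow_le_of_mem_returns (hB : IsPreBrownianReal B P) (hY : Y ∈ returns p P B) :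
    ∫⁻ ω, ENNReal.ofReal (Y ω ^ p.α) ∂P ≤ ENNReal.ofReal (Real.exp (p.h * p.τ)) := by
  have hα := sub_pos.2 hp.α_lt_one
  refine ((isPricingKernel_kernelZ hB p p.τ).lintegral_rpow_le
    ⟨hp.α_pos, hp.α_lt_one⟩ hY).trans_eq ?_
  rw [lintegral_kernelZ_rpow hB, ENNReal.ofReal_rpow_of_pos (Real.exp_pos _), ← Real.exp_mul,
    Params.h]
  congr 2
  field_simp
  ring

lemma integrable_rpow (hB : IsPreBrownianReal B P) (hY : Y ∈ returns p P B) :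
    Integrable (fun ω => Y ω ^ p.α) P := by
  refine ⟨((isPricingKernel_kernelZ hB p p.τ).aemeasurable_of_measurable
    (hY.1.pow_const _)).aestronglyMeasurable, (hasFiniteIntegral_iff_ofReal
      (ae_of_all _ fun ω => Real.rpow_nonneg (hY.2.1 ω) _)).2 ?_⟩
  exact (hp.lintegral_rpow_le_of_mem_returns hB hY).trans_lt ENNReal.ofReal_lt_top

lemma integral_rpow_le (hB : IsPreBrownianReal B P) (hY : Y ∈ returns p P B) :
    ∫ ω, Y ω ^ p.α ∂P ≤ Real.exp (p.h * p.τ) := by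
  rw [← ENNReal.ofReal_le_ofReal_iff (Real.exp_pos _).le, ofReal_integral_eq_lintegral_ofReal
    (hp.integrable_rpow hB hY) (ae_of_all _ fun ω => Real.rpow_nonneg (hY.2.1 ω) _)]
  exact hp.lintegral_rpow_le_of_mem_returns hB hY

end Params.Standing

lemma integral_rpow_nonneg (hY : Y ∈ returns p P B) : 0 ≤ ∫ ω, Y ω ^ p.α ∂P :=
  integral_nonneg fun ω => Real.rpow_nonneg (hY.2.1 ω) _

end Market

section ValueFunction

lemma lipschitzWith_sSup_image {ι X : Type*} [PseudoMetricSpace X] {S : Set ι} {f : X → ι → ℝ}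
    {K : ℝ≥0} (hS : S.Nonempty) (hbdd : ∀ x, BddAbove (f x '' S))
    (hf : ∀ i ∈ S, LipschitzWith K fun x => f x i) :
    LipschitzWith K fun x => sSup (f x '' S) := by
  refine LipschitzWith.of_le_add_mul K fun x x' => csSup_le (hS.image _) ?_
  rintro _ ⟨i, hi, rfl⟩
  have h := (hf i hi).dist_le_mul x x'
  have hle : f x' i ≤ sSup (f x' '' S) := le_csSup (hbdd x') ⟨i, hi, rfl⟩
  linarith [(abs_le.1 (Real.dist_eq (f x i) _ ▸ h)).2]

lemma exists_frequently_add_le_and_le {Ω : Type*} [MeasurableSpace Ω] {P : Measure Ω}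
    {Y : Ω → ℝ} {a : ℝ} (Z : Ω → ℝ) (h : ¬ ∀ᵐ ω ∂P, Y ω ≤ a) :
    ∃ c > 0, ∃ N, ∃ᵐ ω ∂P, a + c ≤ Y ω ∧ Z ω ≤ N := by
  contrapose! h
  have hnat : ∀ᵐ ω ∂P, ∀ n : ℕ, a + 1 / ((n : ℝ) + 1) ≤ Y ω → n < Z ω :=
    ae_all_iff.2 fun n => h _ (by positivity) _
  filter_upwards [hnat] with ω hω
  by_contra! hY
  obtain ⟨n₁, hn₁⟩ := exists_nat_one_div_lt (sub_pos.2 hY)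
  obtain ⟨n₂, hn₂⟩ := exists_nat_ge (Z ω)
  refine (hω (max n₁ n₂) ?_).not_ge (hn₂.trans (mod_cast le_max_right _ _))
  have : 1 / (((max n₁ n₂ : ℕ) : ℝ) + 1) ≤ 1 / ((n₁ : ℝ) + 1) :=
    Nat.one_div_le_one_div (le_max_left _ _)
  linarith

variable {Ω : Type*} [MeasurableSpace Ω] {P : Measure Ω} [IsProbabilityMeasure P]
  {B : ℝ≥0 → Ω → ℝ} {p : Params} {Y : Ω → ℝ} {θ θ' : ℝ}

namespace Params.Standing

variable (hp : p.Standing) (hB : IsPreBrownianReal B P)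
include hp hB

lemma integrable_F (hY : Y ∈ returns p P B) (θ : ℝ) : Integrable (fun ω => p.F (Y ω) θ) P := by
  have hYm := (isPricingKernel_kernelZ hB p p.τ).aemeasurable_of_measurable hY.1
  refine Integrable.mono' (((hp.integrable_rpow hB hY).add
    (integrable_const (p.γ ^ p.α))).const_mul (1 + p.k + |θ|))
    ((p.measurable_F θ).comp_aemeasurable hYm).aestronglyMeasurable
    (ae_of_all _ fun ω => hp.abs_F_le (hY.2.1 ω))

lemma objective_eq_add (hY : Y ∈ returns p P B) (θ θ' : ℝ) :
    objective p P θ' Y = objective p P θ Y + (θ' - θ) * ∫ ω, Y ω ^ p.α ∂P := by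
  rw [objective, objective, ← integral_const_mul,
    ← integral_add (hp.integrable_F hB hY θ) ((hp.integrable_rpow hB hY).const_mul _)]
  congr 1 with ω
  rw [Params.F, Params.F]
  ring

lemma bddAbove_objective (θ : ℝ) : BddAbove (objective p P θ '' returns p P B) := by
  refine ⟨(1 + p.k + |θ|) * (Real.exp (p.h * p.τ) + p.γ ^ p.α), ?_⟩
  rintro _ ⟨Y, hY, rfl⟩
  have hi := hp.integrable_rpow hB hY
  have hk : 0 ≤ 1 + p.k + |θ| := by linarith [hp.k_nonneg, abs_nonneg θ]
  calc objective p P θ Y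
      ≤ ∫ ω, (1 + p.k + |θ|) * (Y ω ^ p.α + p.γ ^ p.α) ∂P :=
        integral_mono (hp.integrable_F hB hY θ)
          ((hi.add (integrable_const _)).const_mul _)
          fun ω => (le_abs_self _).trans (hp.abs_F_le (hY.2.1 ω))
    _ = (1 + p.k + |θ|) * (∫ ω, Y ω ^ p.α ∂P + p.γ ^ p.α) := by
        rw [integral_const_mul, integral_add hi (integrable_const _), integral_const,
          probReal_univ, one_smul]
    _ ≤ (1 + p.k + |θ|) * (Real.exp (p.h * p.τ) + p.γ ^ p.α) := by
        gcongr
        exact hp.integral_rpow_le hB hY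

lemma objective_le_Phi (hY : Y ∈ returns p P B) (θ : ℝ) : objective p P θ Y ≤ Phi p P B θ :=
  le_csSup (hp.bddAbove_objective hB θ) ⟨Y, hY, rfl⟩

lemma mem_argmaxSet_iff :
    Y ∈ argmaxSet p P B θ ↔ Y ∈ returns p P B ∧ Phi p P B θ ≤ objective p P θ Y := by
  refine and_congr_right fun hY => ⟨fun h => ?_, fun h Y' hY' =>
    (hp.objective_le_Phi hB hY' θ).trans h⟩
  exact csSup_le ⟨_, Y, hY, rfl⟩ (Set.forall_mem_image.2 h)

lemma lipschitzWith_Phi : LipschitzWith (Real.exp (p.h * p.τ)).toNNReal (Phi p P B) := by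
  refine lipschitzWith_sSup_image ⟨0, zero_mem_budgetSet⟩ (hp.bddAbove_objective hB)
    fun Y hY => LipschitzWith.of_dist_le_mul fun θ θ' => ?_
  rw [Real.coe_toNNReal _ (Real.exp_pos _).le, hp.objective_eq_add hB hY θ' θ, Real.dist_eq,
    add_sub_cancel_left, abs_mul, abs_of_nonneg (integral_rpow_nonneg hY), mul_comm, Real.dist_eq]
  gcongr
  exact hp.integral_rpow_le hB hY

lemma Phi_add_le_of_mem_argmaxSet (hY : Y ∈ argmaxSet p P B θ) (θ' : ℝ) :
    Phi p P B θ + (θ' - θ) * ∫ ω, Y ω ^ p.α ∂P ≤ Phi p P B θ' :=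
  calc Phi p P B θ + (θ' - θ) * ∫ ω, Y ω ^ p.α ∂P
      ≤ objective p P θ Y + (θ' - θ) * ∫ ω, Y ω ^ p.α ∂P := by
        gcongr
        exact ((hp.mem_argmaxSet_iff hB).1 hY).2
    _ = objective p P θ' Y := (hp.objective_eq_add hB hY.1 θ θ').symm
    _ ≤ Phi p P B θ' := hp.objective_le_Phi hB hY.1 θ'

lemma exists_deriv_F_eq_const_mul {c : ℝ} (hc : 0 < c) (hY : Y ∈ argmaxSet p P B θ) (N : ℝ) :
    ∃ b, ∀ᵐ ω ∂P, p.γ + c ≤ Y ω ∧ kernelZ p B p.τ ω ≤ N →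
      deriv (fun y => p.F y θ) (Y ω) = b * kernelZ p B p.τ ω := by
  have hγ := hp.γ_pos
  have hdiff (y : ℝ) (hy : p.γ + c / 2 < y) : DifferentiableAt ℝ (fun y => p.F y θ) y :=
    (hp.hasDerivAt_F (by linarith)).differentiableAt
  obtain ⟨b, hb⟩ := (isPricingKernel_kernelZ hB p p.τ).exists_deriv_eq_const_mul
    (p.measurable_F θ) (by positivity) (half_pos hc) hdiff hY.1 (hp.integrable_F hB hY.1 θ) hY.2
    ⟨_, fun y hy => hp.abs_deriv_F_le (half_pos hc) hy⟩ N
  exact ⟨b, by simpa only [add_assoc, add_halves] using hb⟩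

lemma eq_of_mem_argmaxSet (hY : Y ∈ argmaxSet p P B θ) (hY' : Y ∈ argmaxSet p P B θ')
    (hYγ : ¬ ∀ᵐ ω ∂P, Y ω ≤ p.γ) : θ = θ' := by
  by_contra hne
  have hpos (ω : Ω) : kernelZ p B p.τ ω ≠ 0 := (Real.exp_pos _).ne'
  obtain ⟨c, hc, N, hfreq⟩ := exists_frequently_add_le_and_le (kernelZ p B p.τ) hYγ
  obtain ⟨b, hb⟩ := hp.exists_deriv_F_eq_const_mul hB hc hY N
  obtain ⟨b', hb'⟩ := hp.exists_deriv_F_eq_const_mul hB hc hY' N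
  obtain ⟨ω₀, hω₀, hb₀, hb₀'⟩ := (hfreq.and_eventually (hb.and hb')).exists
  have hatom : ∀ᵐ ω ∂P, kernelZ p B p.τ ω ≠ kernelZ p B p.τ ω₀ :=
    measure_eq_zero_iff_ae_notMem.1
      (measure_preimage_kernelZ_singleton hB hp.φ_ne_zero hp.τ_pos.ne' _)
  refine hfreq ?_
  filter_upwards [hb, hb', hatom] with ω hbω hbω' hZω hω
  exact hZω (hp.eq_of_deriv_F_eq_mul hne (by linarith [hω.1]) (by linarith [hω₀.1]) (hpos ω)
    (hbω hω) (hbω' hω) (hb₀ hω₀) (hb₀' hω₀))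

lemma not_ae_le_of_mem_argmaxSet (hθ : p.thetaLow < θ) (hY : Y ∈ argmaxSet p P B θ) :
    ¬ ∀ᵐ ω ∂P, Y ω ≤ p.γ := by
  obtain ⟨y₀, hy₀, hlt⟩ := hp.exists_lt_F_of_thetaLow_lt hθ
  exact (isPricingKernel_kernelZ hB p p.τ).not_ae_le_of_isMaxOn
    (measure_preimage_kernelZ_singleton hB hp.φ_ne_zero hp.τ_pos.ne')
    (fun ε hε => measure_kernelZ_lt_ne_zero hB hp.φ_ne_zero hp.τ_pos.ne' hε)
    (fun Y hY => hp.integrable_F hB hY θ) hp.γ_pos.le (fun y hy => hp.F_le_max hy) hy₀ hlt hY.1 hY.2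

lemma Phi_add_lt_of_mem_argmaxSet (hθ : p.thetaLow < θ) (hY : Y ∈ argmaxSet p P B θ)
    (hne : θ ≠ θ') : Phi p P B θ + (θ' - θ) * ∫ ω, Y ω ^ p.α ∂P < Phi p P B θ' := by
  by_contra! hle
  have hY' : Y ∈ argmaxSet p P B θ' := by
    refine (hp.mem_argmaxSet_iff hB).2 ⟨hY.1, hle.trans ?_⟩
    rw [hp.objective_eq_add hB hY.1 θ θ']
    gcongr
    exact ((hp.mem_argmaxSet_iff hB).1 hY).2
  exact hne (hp.eq_of_mem_argmaxSet hB hY hY' (hp.not_ae_le_of_mem_argmaxSet hB hθ hY))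

end Params.Standing

end ValueFunction

section Comparison

lemma Params.Standing.discount_mul_exp_lt_one {p : Params} (hp : p.Standing) :
    Real.exp (-p.δ * p.τ) * Real.exp (p.h * p.τ) < 1 := by
  rw [← Real.exp_add, ← add_mul, Real.exp_lt_one_iff]
  exact mul_neg_of_neg_of_pos (by linarith [hp.h_lt_δ]) hp.τ_pos

lemma Params.Standing.thetaLow_neg {p : Params} (hp : p.Standing) : p.thetaLow < 0 :=
  neg_lt_zero.2 <| Real.rpow_pos_of_pos
    (add_pos_of_pos_of_nonneg one_pos (Real.rpow_nonneg hp.k_nonneg _)) _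

variable {p : Params} {β ξ κ : ℝ}

lemma kappa_mem_Ioo (hβ : β ∈ Set.Ioo 0 1) (hξ : Real.exp (-p.δ * p.τ) * ξ < 1) :
    kappa p β ξ ∈ Set.Ioo 0 1 := by
  have hden : β < 1 - (1 - β) * Real.exp (-p.δ * p.τ) * ξ := by
    have := mul_lt_mul_of_pos_left hξ (sub_pos.2 hβ.2)
    linarith
  have hden0 := hβ.1.trans hden
  exact ⟨div_pos hβ.1 hden0, (div_lt_one hden0).2 hden⟩

lemma kappa_mul_div_eq (hβ : β ∈ Set.Ioo 0 1) (hξ : Real.exp (-p.δ * p.τ) * ξ < 1) (θ : ℝ) :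
    kappa p β ξ * θ / β
      = θ + (kappa p β ξ * θ / β - kappa p β ξ * θ) * (Real.exp (-p.δ * p.τ) * ξ) := by
  have hβ0 := hβ.1.ne'
  have hden : 1 - (1 - β) * Real.exp (-p.δ * p.τ) * ξ ≠ 0 := fun h0 =>
    (kappa_mem_Ioo hβ hξ).1.ne' (by rw [kappa, h0, div_zero])
  rw [kappa]
  generalize Real.exp (-p.δ * p.τ) = a at hden ⊢
  field_simp
  ring

variable {Ω : Type*} [MeasurableSpace Ω] {P : Measure Ω} {B : ℝ≥0 → Ω → ℝ}

/-- The discounted value `e ^ (-δτ) Φ(θ)` of a period with continuation weight `θ`. The constants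
`θ*(κ)` are the fixed points of `θ ↦ discountedPhi p P B (κ * θ)`. -/
noncomputable def discountedPhi (p : Params) (P : Measure Ω) (B : ℝ≥0 → Ω → ℝ) (θ : ℝ) : ℝ :=
  Real.exp (-p.δ * p.τ) * Phi p P B θ

namespace Params.Standing

variable (hp : p.Standing) (hB : IsPreBrownianReal B P)
include hp hB

lemma discount_mul_lt_one (hξ : ξ ∈ mapG p P B β κ) : Real.exp (-p.δ * p.τ) * ξ < 1 := by
  obtain ⟨Y, hY, rfl⟩ := hξ
  exact (mul_le_mul_of_nonneg_left (hp.integral_rpow_le hB hY.1) (Real.exp_pos _).le).trans_lt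
    hp.discount_mul_exp_lt_one

variable [IsProbabilityMeasure P]

lemma contractingWith_discountedPhi :
    ContractingWith (Real.exp (-p.δ * p.τ) * Real.exp (p.h * p.τ)).toNNReal
      (discountedPhi p P B) := by
  refine ⟨Real.toNNReal_lt_one.2 hp.discount_mul_exp_lt_one,
    LipschitzWith.of_dist_le_mul fun x y => ?_⟩
  have hΦ := (hp.lipschitzWith_Phi hB).dist_le_mul x y
  rw [Real.coe_toNNReal _ (Real.exp_pos _).le] at hΦ
  rw [Real.coe_toNNReal _ (by positivity), discountedPhi, discountedPhi, Real.dist_eq, ← mul_sub,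
    abs_mul, Real.abs_exp, mul_assoc]
  gcongr
  exact hΦ

lemma discountedPhi_mul_thetaStar (hκ : κ ∈ Set.Icc 0 1) :
    discountedPhi p P B (κ * thetaStar p P B κ) = thetaStar p P B κ :=
  Classical.epsilon_spec
    (p := fun θ : ℝ => Function.IsFixedPt (fun x => discountedPhi p P B (κ * x)) θ)
    ⟨_, (contractingWith_comp_const_mul (hp.contractingWith_discountedPhi hB)
      hκ).fixedPoint_isFixedPt⟩

lemma Amy_eq : Amy p P B = discountedPhi p P B 0 := by
  have h := hp.discountedPhi_mul_thetaStar hB (κ := 0) ⟨le_rfl, zero_le_one⟩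
  rw [zero_mul] at h
  exact h.symm

lemma thetaStar_pos_iff (hκ : κ ∈ Set.Icc 0 1) : 0 < thetaStar p P B κ ↔ 0 < Amy p P B := by
  rw [lt_fixedPt_iff (strictAnti_sub_id_of_contractingWith (contractingWith_comp_const_mul
    (hp.contractingWith_discountedPhi hB) hκ)) (hp.discountedPhi_mul_thetaStar hB hκ), mul_zero,
    hp.Amy_eq hB]

lemma thetaStar_neg_iff (hκ : κ ∈ Set.Icc 0 1) : thetaStar p P B κ < 0 ↔ Amy p P B < 0 := by
  rw [fixedPt_lt_iff (strictAnti_sub_id_of_contractingWith (contractingWith_comp_const_mul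
    (hp.contractingWith_discountedPhi hB) hκ)) (hp.discountedPhi_mul_thetaStar hB hκ), mul_zero,
    hp.Amy_eq hB]

lemma thetaStar_eq_zero (hκ : κ ∈ Set.Icc 0 1) (h : Amy p P B = 0) : thetaStar p P B κ = 0 :=
  le_antisymm (not_lt.1 fun hlt => ((hp.thetaStar_pos_iff hB hκ).1 hlt).ne' h)
    (not_lt.1 fun hlt => ((hp.thetaStar_neg_iff hB hκ).1 hlt).ne h)

lemma discountedPhi_Aexpo : discountedPhi p P B (Aexpo p P B) = Aexpo p P B := by
  have h := hp.discountedPhi_mul_thetaStar hB (κ := 1) ⟨zero_le_one, le_rfl⟩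
  rwa [one_mul] at h

lemma strictAnti_discountedPhi_sub_id : StrictAnti fun x => discountedPhi p P B x - x :=
  strictAnti_sub_id_of_contractingWith (hp.contractingWith_discountedPhi hB)

variable (hβ : β ∈ Set.Ioo 0 1) (hξ : ξ ∈ mapG p P B β ξ)
include hβ hξ

lemma discountedPhi_Aso : discountedPhi p P B (Aso p P B β ξ) = thetaStar p P B (kappa p β ξ) :=
  hp.discountedPhi_mul_thetaStar hB
    (Set.Ioo_subset_Icc_self (kappa_mem_Ioo hβ (hp.discount_mul_lt_one hB hξ)))

/-- At a fixed point `ξ` the extrapolation of `discountedPhi` from `A_so` along the subgradient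
`e ^ (-δτ) ξ` meets the diagonal at `A_so / β`. -/
lemma Aso_div_eq : Aso p P B β ξ / β = Real.exp (-p.δ * p.τ) *
    (Phi p P B (Aso p P B β ξ) + (Aso p P B β ξ / β - Aso p P B β ξ) * ξ) := by
  have h := kappa_mul_div_eq hβ (hp.discount_mul_lt_one hB hξ) (thetaStar p P B (kappa p β ξ))
  rw [← Aso, ← hp.discountedPhi_Aso hB hβ hξ, discountedPhi] at h
  linarith

lemma Aso_le_mul_Aexpo : Aso p P B β ξ ≤ β * Aexpo p P B := by
  rw [mul_comm, ← div_le_iff₀ hβ.1,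
    le_fixedPt_iff (hp.strictAnti_discountedPhi_sub_id hB) (hp.discountedPhi_Aexpo hB)]
  refine (hp.Aso_div_eq hB hβ hξ).trans_le (mul_le_mul_of_nonneg_left ?_ (Real.exp_pos _).le)
  obtain ⟨Y, hY, hYξ : ∫ ω, Y ω ^ p.α ∂P = ξ⟩ := hξ
  have hsub := hp.Phi_add_le_of_mem_argmaxSet hB hY (Aso p P B β ξ / β)
  rwa [hYξ] at hsub

lemma Aso_lt_mul_Aexpo (h0 : Aso p P B β ξ ≠ 0) (hθ : p.thetaLow < Aso p P B β ξ) :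
    Aso p P B β ξ < β * Aexpo p P B := by
  have hne : Aso p P B β ξ ≠ Aso p P B β ξ / β := by
    rw [Ne, eq_div_iff hβ.1.ne', mul_eq_left₀ h0]
    exact hβ.2.ne
  rw [mul_comm, ← div_lt_iff₀ hβ.1,
    lt_fixedPt_iff (hp.strictAnti_discountedPhi_sub_id hB) (hp.discountedPhi_Aexpo hB)]
  refine (hp.Aso_div_eq hB hβ hξ).trans_lt (mul_lt_mul_of_pos_left ?_ (Real.exp_pos _))
  obtain ⟨Y, hY, hYξ : ∫ ω, Y ω ^ p.α ∂P = ξ⟩ := hξ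
  have hsub := hp.Phi_add_lt_of_mem_argmaxSet hB hθ hY hne
  rwa [hYξ] at hsub

lemma Aexpo_lt_Aso (h : thetaStar p P B (kappa p β ξ) < 0) : Aexpo p P B < Aso p P B β ξ := by
  rw [fixedPt_lt_iff (hp.strictAnti_discountedPhi_sub_id hB) (hp.discountedPhi_Aexpo hB),
    hp.discountedPhi_Aso hB hβ hξ, Aso]
  exact lt_mul_of_lt_one_left h (kappa_mem_Ioo hβ (hp.discount_mul_lt_one hB hξ)).2

end Params.Standing

end Comparison

end PeriodicPortfolio

open PeriodicPortfolio in
theorem mainTheorem7_general {Ω : Type*} [MeasurableSpace Ω]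
    (P : Measure Ω) [IsProbabilityMeasure P]
    (B : ℝ≥0 → Ω → ℝ) (hB : IsPreBrownianReal B P)
    (p : PeriodicPortfolio.Params) (hp : p.Standing)
    (β : ℝ) (hβ : β ∈ Set.Ioo (0 : ℝ) 1)
    (ξ : ℝ) (hfix : ξ ∈ mapG p P B β ξ) :
    (Amy p P B = 0 →
      β * Aexpo p P B = 0 ∧ Aexpo p P B = 0 ∧ Aso p P B β ξ = 0) ∧
    (0 < Amy p P B →
      0 < Aso p P B β ξ ∧ Aso p P B β ξ < β * Aexpo p P B ∧ β * Aexpo p P B < Aexpo p P B ∧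
      betaHat p P B β ξ ∈ Set.Ioo 0 β) ∧
    (Amy p P B < 0 →
      Aexpo p P B < Aso p P B β ξ ∧ Aso p P B β ξ ≤ β * Aexpo p P B ∧ β * Aexpo p P B < 0 ∧
      betaHat p P B β ξ ∈ Set.Ico β 1 ∧
      (p.thetaLow ≤ Aexpo p P B →
        Aso p P B β ξ < β * Aexpo p P B ∧ β < betaHat p P B β ξ)) := by
  have hκ := kappa_mem_Ioo hβ (hp.discount_mul_lt_one hB hfix)
  have hκ' := Set.Ioo_subset_Icc_self hκ
  have h1 : (1 : ℝ) ∈ Set.Icc 0 1 := ⟨zero_le_one, le_rfl⟩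
  have hle := hp.Aso_le_mul_Aexpo hB hβ hfix
  refine ⟨fun h => ?_, fun h => ?_, fun h => ?_⟩
  · have hE : Aexpo p P B = 0 := hp.thetaStar_eq_zero hB h1 h
    have hA : Aso p P B β ξ = 0 := mul_eq_zero_of_right _ (hp.thetaStar_eq_zero hB hκ' h)
    exact ⟨mul_eq_zero_of_right _ hE, hE, hA⟩
  · have hE : 0 < Aexpo p P B := (hp.thetaStar_pos_iff hB h1).2 h
    have hA : 0 < Aso p P B β ξ := mul_pos hκ.1 ((hp.thetaStar_pos_iff hB hκ').2 h)
    have hlt := hp.Aso_lt_mul_Aexpo hB hβ hfix hA.ne' (hp.thetaLow_neg.trans hA)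
    exact ⟨hA, hlt, mul_lt_of_lt_one_left hE hβ.2, div_pos hA hE, (div_lt_iff₀ hE).2 hlt⟩
  · have hE : Aexpo p P B < 0 := (hp.thetaStar_neg_iff hB h1).2 h
    have hθ := (hp.thetaStar_neg_iff hB hκ').2 h
    have hA : Aso p P B β ξ < 0 := mul_neg_of_pos_of_neg hκ.1 hθ
    have hEA := hp.Aexpo_lt_Aso hB hβ hfix hθ
    refine ⟨hEA, hle, mul_neg_of_pos_of_neg hβ.1 hE, ⟨(le_div_iff_of_neg hE).2 hle,
      (div_lt_one_of_neg hE).2 hEA⟩, fun hlow => ?_⟩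
    have hlt := hp.Aso_lt_mul_Aexpo hB hβ hfix hA.ne (hlow.trans_lt hEA)
    exact ⟨hlt, (lt_div_iff_of_neg hE).2 hlt⟩

theorem mainTheorem7 {Ω : Type*} [MeasurableSpace Ω]
    (P : Measure Ω) [IsProbabilityMeasure P] [P.IsComplete]
    (B : ℝ≥0 → Ω → ℝ) (hB : IsBrownianReal B P)
    (p : PeriodicPortfolio.Params) (hp : p.Standing)
    (β : ℝ) (hβ : β ∈ Set.Ioo (0 : ℝ) 1)
    (ξ : ℝ) (hξ : ξ ∈ Set.Icc 0 (Real.exp (p.h * p.τ)))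
    (hfix : ξ ∈ PeriodicPortfolio.mapG p P B β ξ) :
    (PeriodicPortfolio.Amy p P B = 0 →
      β * PeriodicPortfolio.Aexpo p P B = 0 ∧
      PeriodicPortfolio.Aexpo p P B = 0 ∧
      PeriodicPortfolio.Aso p P B β ξ = 0) ∧
    (0 < PeriodicPortfolio.Amy p P B →
      0 < PeriodicPortfolio.Aso p P B β ξ ∧
      PeriodicPortfolio.Aso p P B β ξ < β * PeriodicPortfolio.Aexpo p P B ∧
      β * PeriodicPortfolio.Aexpo p P B < PeriodicPortfolio.Aexpo p P B ∧
      PeriodicPortfolio.betaHat p P B β ξ ∈ Set.Ioo 0 β) ∧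
    (PeriodicPortfolio.Amy p P B < 0 →
      PeriodicPortfolio.Aexpo p P B < PeriodicPortfolio.Aso p P B β ξ ∧
      PeriodicPortfolio.Aso p P B β ξ ≤ β * PeriodicPortfolio.Aexpo p P B ∧
      β * PeriodicPortfolio.Aexpo p P B < 0 ∧
      PeriodicPortfolio.betaHat p P B β ξ ∈ Set.Ico β 1 ∧
      (p.thetaLow ≤ PeriodicPortfolio.Aexpo p P B →
        PeriodicPortfolio.Aso p P B β ξ < β * PeriodicPortfolio.Aexpo p P B ∧
        β < PeriodicPortfolio.betaHat p P B β ξ)) := by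
  exact mainTheorem7_general P B hB.toIsPreBrownianReal p hp β hβ ξ hfix
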